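/- Let $X$ be a real separable Banach space with the Schur property (every weakly convergent sequence in $X$ converges in norm to its weak limit), and let $A\subseteq X$ be nonempty. Then the following are equivalent: (i) $(A,w)$, that is, $A$ with the relative weak topology of $X$, is strongly $\mathcal{K}$-analytic; (ii) $A$ is a $G_\delta$ subset of $(X,\|\cdot\|)$; (ii') $(A,\|\cdot\|)$ is a Polish space; (iii) $A$, regarded as a subset of $X^{**}$ under the canonical embedding $X\to X^{**}$, is a strongly $\mathcal{K}_{\sigma\delta}$ subset of $(X^{**},w^*)$. Here a topological space $Y$ is called strongly $\mathcal{K}$-analytic if there is a map $F$ from $\mathbb{N}^{\mathbb{N}}$ (with the product topology) to the nonempty compact subsets of $Y$ such that: $F$ is upper semicontinuous (for every $\sigma$ and every open $V\supseteq F(\sigma)$ there is a neighbourhood $W$ of $\sigma$ with $F(\tau)\subseteq V$ for all $\tau\in W$); $\bigcup_{\sigma}F(\sigma)=Y$; and for every compact $L\subseteq Y$ there is $\sigma$ with $L\subseteq F(\sigma)$. A subset $B$ of a topological space $Y$ is called strongly $\mathcal{K}_{\sigma\delta}$ if there are compact sets $K_{n,m}\subseteq Y$ $(n,m\in\mathbb{N})$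 such that $B=\bigcap_{n}\bigcup_{m}K_{n,m}$ and, for each compact $L\subseteq B$ and each $n$, there is $m$ with $L\subseteq K_{n,m}$. -/

import Mathlib

open Set Filter Topology

/-- A topological space `Y` is strongly K-analytic if there is an upper semicontinuous map `F` from
the Baire space `ℕ → ℕ` to the nonempty compact subsets of `Y` whose values cover `Y` and such that
every compact subset of `Y` is contained in a single value of `F`. -/
def IsStronglyKAnalytic (Y : Type*) [TopologicalSpace Y] : Prop :=
  ∃ F : (ℕ → ℕ) → TopologicalSpace.NonemptyCompacts Y,
    UpperHemicontinuous (fun σ => (F σ : Set Y)) ∧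
    (⋃ σ, (F σ : Set Y)) = univ ∧
    ∀ L : Set Y, IsCompact L → ∃ σ, L ⊆ (F σ : Set Y)

/-- A subset `A` of a topological space `Y` is strongly `K_{σδ}` in `Y` if `A = ⋂ n, ⋃ m, K n m` for
some compact subsets `K n m` of `Y` such that for every `n` each compact subset of `A` is
contained in `K n m` for some `m`. -/
def IsStronglyKSigmaDelta {Y : Type*} [TopologicalSpace Y] (A : Set Y) : Prop :=
  ∃ K : ℕ → ℕ → Set Y,
    (∀ n m, IsCompact (K n m)) ∧
    A = ⋂ n, ⋃ m, K n m ∧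
    ∀ L : Set Y, IsCompact L → L ⊆ A → ∀ n, ∃ m, L ⊆ K n m

/-- The Schur property: weakly convergent sequences are norm convergent. -/
def HasSchurProperty (X : Type*) [NormedAddCommGroup X] [NormedSpace ℝ X] : Prop :=
  ∀ (u : ℕ → X) (x : X),
    Tendsto (fun n => toWeakSpace ℝ X (u n)) atTop (𝓝 (toWeakSpace ℝ X x)) →
    Tendsto u atTop (𝓝 x)

/-! ### Polish subspaces and `Gδ` sets -/

/-! The hub is the `G_δ` condition. From (i), a compact-covering upper semicontinuous map on Baire
space yields a tree of norm-open sets: gluing bad compacts shrinking to a point shows that each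
point of `A` in a node lies in a child, and a point of the closure of `A` with an infinite branch
lies in `A`. This needs only that the weak topology is Hausdorff and coarser than the norm. From a
`G_δ`, cover the `n`-th open set by balls of radius at most `1/(n+1)`. Finite unions of their bidual
counterparts are weak* compact; shrinking radii force common points back into `X`, and Schur
supplies cofinality, as weakly compact sets are norm compact. Intersecting such compacts along a
sequence gives (i). -/

theorem IsGδ.polishSpace {X : Type*} [TopologicalSpace X] [PolishSpace X] {A : Set X}
    (hA : IsGδ A) : PolishSpace A := by
  obtain ⟨U, hU, rfl⟩ := isGδ_iff_eq_iInter_nat.1 hA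
  have := fun n => (hU n).polishSpace
  let f : (⋂ n, U n : Set X) → ∀ n, U n := fun x n => ⟨x, mem_iInter.1 x.2 n⟩
  have hf : Continuous f := by fun_prop
  have hg : Topology.IsEmbedding f := by
    refine .of_comp hf (g := fun y => (y 0 : X)) (by fun_prop) ?_
    exact Topology.IsEmbedding.subtypeVal
  refine Topology.IsClosedEmbedding.polishSpace (f := f) ⟨hg, ?_⟩
  have : range f = {y | ∀ n, (y n : X) = y 0} := by
    ext y
    constructor
    · rintro ⟨x, rfl⟩ n
      rfl
    · intro hy
      refine ⟨⟨y 0, mem_iInter.2 fun n => ?_⟩, ?_⟩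
      · rw [← hy n]
        exact (y n).2
      · ext n
        exact (hy n).symm
  rw [this, ofPred_forall]
  exact isClosed_iInter fun n => isClosed_eq (by fun_prop) (by fun_prop)

/-- At a closure point lying in every `O n`, the neighbourhood filter traces a Cauchy filter on `A`;
its limit in `A` must be that point. -/
theorem IsGδ.of_isCompletelyMetrizableSpace {X : Type*} [TopologicalSpace X]
    [TopologicalSpace.MetrizableSpace X] {A : Set X}
    [TopologicalSpace.IsCompletelyMetrizableSpace A] : IsGδ A := by
  let := TopologicalSpace.upgradeIsCompletelyMetrizable A
  let O : ℕ → Set X := fun n =>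
    ⋃₀ {V | IsOpen V ∧ ∀ a b : A, (a : X) ∈ V → (b : X) ∈ V → dist a b < 1 / ((n : ℝ) + 1)}
  have hO : ∀ n, IsOpen (O n) := fun n => isOpen_sUnion fun V hV => hV.1
  suffices A = closure A ∩ ⋂ n, O n by
    rw [this]
    exact isClosed_closure.isGδ.inter (.iInter_of_isOpen hO)
  refine Subset.antisymm (fun a ha => ⟨subset_closure ha, mem_iInter.2 fun n => ?_⟩) ?_
  · obtain ⟨V, hV, hVb⟩ := isOpen_induced_iff.1
      (Metric.isOpen_ball (x := (⟨a, ha⟩ : A)) (ε := 1 / ((n : ℝ) + 1) / 2))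
    have hmem : ∀ b : A, (b : X) ∈ V → dist b ⟨a, ha⟩ < 1 / ((n : ℝ) + 1) / 2 := fun b hb => by
      have : b ∈ Subtype.val ⁻¹' V := hb
      rwa [hVb] at this
    refine ⟨V, ⟨hV, fun b c hb hc => ?_⟩, ?_⟩
    · have := dist_triangle_right b c ⟨a, ha⟩
      linarith [hmem b hb, hmem c hc]
    · have : (⟨a, ha⟩ : A) ∈ Subtype.val ⁻¹' V := by
        rw [hVb]
        exact Metric.mem_ball_self (by positivity)
      exact this
  · rintro x ⟨hx, hxO⟩
    have : (comap ((↑) : A → X) (𝓝 x)).NeBot := mem_closure_iff_comap_neBot.1 hx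
    have hc : Cauchy (comap ((↑) : A → X) (𝓝 x)) := by
      refine Metric.cauchy_iff.2 ⟨this, fun ε hε => ?_⟩
      obtain ⟨n, hn⟩ := exists_nat_one_div_lt hε
      obtain ⟨V, ⟨hV, hVd⟩, hxV⟩ := mem_iInter.1 hxO n
      exact ⟨_, preimage_mem_comap (hV.mem_nhds hxV),
        fun a ha b hb => (hVd a b ha hb).trans hn⟩
    obtain ⟨a, ha⟩ := CompleteSpace.complete hc
    have h1 : Tendsto ((↑) : A → X) (comap ((↑) : A → X) (𝓝 x)) (𝓝 (a : X)) :=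
      (continuous_subtype_val.tendsto a).mono_left ha
    rw [tendsto_nhds_unique tendsto_comap h1]
    exact a.2

/-! ### Strongly K-analytic subsets of metrizable spaces -/

theorem isCompact_insert_iUnion_of_subset {X : Type*} [TopologicalSpace X] {a : X}
    {V K : ℕ → Set X} (hV : (𝓝 a).HasAntitoneBasis V) (hK : ∀ n, IsCompact (K n))
    (hKV : ∀ n, K n ⊆ V n) : IsCompact (insert a (⋃ n, K n)) := by
  refine isCompact_iff_ultrafilter_le_nhds.2 fun u hu => ?_
  by_cases h : ∃ n, K n ∈ u
  · obtain ⟨n, hn⟩ := h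
    obtain ⟨x, hx, hux⟩ := isCompact_iff_ultrafilter_le_nhds.1 (hK n) u (le_principal_iff.2 hn)
    exact ⟨x, .inr (mem_iUnion.2 ⟨n, hx⟩), hux⟩
  push Not at h
  refine ⟨a, mem_insert _ _, hV.1.ge_iff.2 fun N _ => ?_⟩
  have h1 : ⋂ n ∈ Finset.range N, (K n)ᶜ ∈ (u : Filter X) :=
    (biInter_finset_mem _).2 fun n _ => Ultrafilter.compl_mem_iff_notMem.2 (h n)
  filter_upwards [h1, le_principal_iff.1 hu] with x hx hxK
  obtain rfl | hxK := hxK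
  · exact mem_of_mem_nhds (hV.1.mem_of_mem trivial)
  obtain ⟨n, hn⟩ := mem_iUnion.1 hxK
  by_cases hnN : n < N
  · exact absurd hn (mem_iInter₂.1 hx n (Finset.mem_range.2 hnN))
  · exact hV.2 (not_lt.1 hnN) (hKV n hn)

/-- `G` asks that every node containing `x` have a child containing `x`; a branch is then followed
greedily from the root. -/
theorem exists_isGδ_forall_exists_branch {X : Type*} [TopologicalSpace X]
    [PerfectlyNormalSpace X] {A : Set X} {W : List ℕ → Set X} (hW : ∀ s, IsOpen (W s))
    (h0 : A ⊆ W []) (hs : ∀ s, A ∩ W s ⊆ ⋃ n, W (s ++ [n])) :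
    ∃ G, IsGδ G ∧ A ⊆ G ∧ ∀ x ∈ G, ∃ σ : ℕ → ℕ, ∀ n, x ∈ W ((List.range n).map σ) := by
  refine ⟨W [] ∩ ⋂ s, ((W s)ᶜ ∪ ⋃ n, W (s ++ [n])), ?_, fun a ha => ⟨h0 ha, ?_⟩, ?_⟩
  · exact (hW _).isGδ.inter (.iInter fun s => (hW s).isClosed_compl.isGδ.union
      (isOpen_iUnion fun n => hW _).isGδ)
  · refine mem_iInter.2 fun s => ?_
    by_cases h : a ∈ W s
    · exact .inr (hs s ⟨ha, h⟩)
    · exact .inl h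
  · rintro x ⟨hx0, hx⟩
    have : ∀ s, ∃ n, x ∈ W s → x ∈ W (s ++ [n]) := fun s => by
      by_cases h : x ∈ W s
      · obtain ⟨n, hn⟩ := mem_iUnion.1 ((mem_iInter.1 hx s).resolve_left (not_not.2 h))
        exact ⟨n, fun _ => hn⟩
      · exact ⟨0, fun h' => absurd h' h⟩
    choose g hg using this
    let p : ℕ → List ℕ := fun n => Nat.rec [] (fun _ s => s ++ [g s]) n
    have hp : ∀ n, p n = (List.range n).map fun k => g (p k) := fun n => by
      induction n with
      | zero => rfl
      | succ n ih =>
        rw [List.range_succ, List.map_append, ← ih]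
        rfl
    refine ⟨fun k => g (p k), fun n => ?_⟩
    rw [← hp]
    induction n with
    | zero => exact hx0
    | succ n ih => exact hg _ ih

theorem IsGδ.of_isStronglyKAnalytic_image {X Z : Type*} [TopologicalSpace X]
    [TopologicalSpace.MetrizableSpace X] [TopologicalSpace Z] [T2Space Z] {f : X → Z}
    (hf : Continuous f) (hinj : Function.Injective f) {A : Set X}
    (hA : IsStronglyKAnalytic (f '' A)) : IsGδ A := by
  obtain ⟨F, hF, -, hcof⟩ := hA
  replace hF := upperHemicontinuous_iff_forall_isOpen.1 hF
  let S : (ℕ → ℕ) → Set X := fun σ => {x | f x ∈ ((↑) '' (F σ : Set (f '' A)) : Set Z)}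
  have hSA : ∀ σ, S σ ⊆ A := by
    rintro σ x ⟨⟨-, a, ha, rfl⟩, -, hx⟩
    rwa [← hinj hx]
  have hScof : ∀ K ⊆ A, IsCompact K → ∃ σ, K ⊆ S σ := fun K hKA hK => by
    have hc : IsCompact ((↑) ⁻¹' (f '' K) : Set (f '' A)) :=
      Topology.IsInducing.subtypeVal.isCompact_preimage' (hK.image hf)
        (by rw [Subtype.range_coe]; exact image_mono hKA)
    obtain ⟨σ, hσ⟩ := hcof _ hc
    exact ⟨σ, fun x hx => ⟨⟨f x, mem_image_of_mem f (hKA hx)⟩, hσ (mem_image_of_mem f hx), rfl⟩⟩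
  -- Upper semicontinuity with compact values in a Hausdorff space gives a sequentially closed
  -- graph.
  have hSlim : ∀ (τ : ℕ → ℕ → ℕ) (σ : ℕ → ℕ) (y : ℕ → X) (x : X), Tendsto τ atTop (𝓝 σ) →
      Tendsto y atTop (𝓝 x) → (∀ n, y n ∈ S (τ n)) → x ∈ S σ := by
    intro τ σ y x hτ hy hyS
    by_contra hx
    have hc : IsCompact ((↑) '' (F σ : Set (f '' A)) : Set Z) :=
      (F σ).isCompact.image continuous_subtype_val
    obtain ⟨V, U, hV, hU, hFV, hxU, hd⟩ :=
      hc.separation_of_notMem hx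
    have h1 : ∀ᶠ n in atTop, (F (τ n) : Set (f '' A)) ⊆ (↑) ⁻¹' V :=
      hτ (hF σ _ (hV.preimage continuous_subtype_val) (image_subset_iff.1 hFV))
    have h2 : ∀ᶠ n in atTop, f (y n) ∈ U := ((hf.tendsto x).comp hy) (hU.mem_nhds hxU)
    obtain ⟨n, hn1, hn2⟩ := (h1.and h2).exists
    obtain ⟨z, hz, hzy⟩ := hyS n
    exact disjoint_left.1 hd (hn1 hz) (by rwa [hzy])
  let good : List ℕ → Set X → Prop := fun s V =>
    ∀ K ⊆ V ∩ A, IsCompact K → ∃ σ, (List.range s.length).map σ = s ∧ K ⊆ S σ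
  obtain ⟨G, hG, hAG, hbr⟩ := exists_isGδ_forall_exists_branch (A := A)
    (W := fun s => ⋃₀ {V | IsOpen V ∧ good s V}) (fun s => isOpen_sUnion fun V hV => hV.1)
    (fun a ha => ⟨univ, ⟨isOpen_univ, fun K hK hKc => by
      obtain ⟨σ, hσ⟩ := hScof K (fun x hx => (hK hx).2) hKc
      exact ⟨σ, rfl, hσ⟩⟩, mem_univ _⟩) (by
      rintro s a ⟨haA, V, ⟨hV, hVs⟩, haV⟩
      by_contra hcon
      obtain ⟨B, hB⟩ := (𝓝 a).exists_antitone_basis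
      have key : ∀ n, ∃ K ⊆ (interior (B n) ∩ V) ∩ A, IsCompact K ∧
          ¬ ∃ σ, (List.range (s ++ [n]).length).map σ = s ++ [n] ∧ K ⊆ S σ := fun n => by
        by_contra! h
        refine hcon (mem_iUnion.2 ⟨n, interior (B n) ∩ V,
          ⟨isOpen_interior.inter hV, h⟩, ?_, haV⟩)
        exact mem_interior_iff_mem_nhds.2 (hB.1.mem_of_mem trivial)
      choose K hK hKc hKn using key
      obtain ⟨σ, hσs, hσ⟩ := hVs (insert a (⋃ n, K n))
        (insert_subset ⟨haV, haA⟩ (iUnion_subset fun n x hx => ⟨(hK n hx).1.2, (hK n hx).2⟩))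
        (isCompact_insert_iUnion_of_subset hB hKc
          fun n x hx => interior_subset (hK n hx).1.1)
      -- One `σ` extending `s` captures all the `K n` at once, including the one indexed by its own
      -- next entry, which was chosen to escape.
      refine hKn (σ s.length) ⟨σ, ?_, fun x hx => hσ (.inr (mem_iUnion.2 ⟨_, hx⟩))⟩
      rw [List.length_append, List.length_singleton, List.range_succ, List.map_append, hσs]
      rfl)
  suffices A = closure A ∩ G by
    rw [this]
    exact isClosed_closure.isGδ.inter hG
  refine Subset.antisymm (fun a ha => ⟨subset_closure ha, hAG ha⟩) ?_
  rintro x ⟨hx, hxG⟩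
  obtain ⟨σ, hσ⟩ := hbr x hxG
  obtain ⟨B, hB⟩ := (𝓝 x).exists_antitone_basis
  have key : ∀ n, ∃ y ∈ B n, ∃ τ : ℕ → ℕ, (∀ k < n, τ k = σ k) ∧ y ∈ S τ := fun n => by
    obtain ⟨V, ⟨hV, hVg⟩, hxV⟩ := hσ n
    obtain ⟨y, ⟨hyB, hyV⟩, hyA⟩ := mem_closure_iff_nhds.1 hx _
      (inter_mem (hB.1.mem_of_mem (i := n) trivial) (hV.mem_nhds hxV))
    obtain ⟨τ, hτ, hyτ⟩ := hVg {y} (singleton_subset_iff.2 ⟨hyV, hyA⟩) isCompact_singleton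
    refine ⟨y, hyB, τ, fun k hk => ?_, hyτ rfl⟩
    rw [List.length_map, List.length_range] at hτ
    exact List.map_inj_left.1 hτ k (List.mem_range.2 hk)
  choose y hyB τ hτ hyτ using key
  refine hSA σ (hSlim τ σ y x (tendsto_pi_nhds.2 fun k => ?_) (hB.tendsto hyB) hyτ)
  refine tendsto_const_nhds.congr' ?_
  filter_upwards [eventually_gt_atTop k] with n hn
  exact (hτ n k hn).symm

/-! ### Strongly `K_{σδ}` sets -/

/-- The values are `⋂ n, K n (σ n)`. Some may be empty, but the `σ` with nonempty value form a
closed set, onto which Baire space retracts. -/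
theorem IsStronglyKSigmaDelta.isStronglyKAnalytic {Y Z : Type*} [TopologicalSpace Y]
    [TopologicalSpace Z] [T2Space Z] [Nonempty Y] {e : Y → Z} (he : Topology.IsEmbedding e)
    (h : IsStronglyKSigmaDelta (range e)) : IsStronglyKAnalytic Y := by
  obtain ⟨K, hK, hr, hcof⟩ := h
  let P : (ℕ → ℕ) → Set Y := fun σ => e ⁻¹' ⋂ n, K n (σ n)
  have hsub : ∀ σ : ℕ → ℕ, ⋂ n, K n (σ n) ⊆ range e := fun σ => by
    rw [hr]
    exact iInter_mono fun n => subset_iUnion _ _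
  have hP : ∀ σ, IsCompact (P σ) := fun σ =>
    he.isInducing.isCompact_preimage'
      ((hK 0 (σ 0)).of_isClosed_subset (isClosed_iInter fun n => (hK n _).isClosed)
        (iInter_subset _ 0)) (hsub σ)
  have hPcof : ∀ L : Set Y, IsCompact L → ∃ σ, L ⊆ P σ := fun L hL => by
    choose σ hσ using hcof (e '' L) (hL.image he.continuous) (image_subset_range _ _)
    exact ⟨σ, image_subset_iff.1 (subset_iInter hσ)⟩
  have husc : UpperHemicontinuous P := by
    refine upperHemicontinuous_iff_forall_isOpen.2 fun σ V hV hσV => ?_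
    obtain ⟨V, hVo, rfl⟩ := he.isInducing.isOpen_iff.1 hV
    have h1 : ⋂ N, ⋂ n ∈ Finset.range (N + 1), K n (σ n) ⊆ V := by
      intro z hz
      have hz' : z ∈ ⋂ n, K n (σ n) := mem_iInter.2 fun n =>
        mem_iInter₂.1 (mem_iInter.1 hz n) n (Finset.self_mem_range_succ n)
      obtain ⟨y, rfl⟩ := hsub σ hz'
      exact hσV hz'
    obtain ⟨N, hN⟩ := exists_subset_nhds_of_isCompact' (U := V)
      (V := fun N => ⋂ n ∈ Finset.range (N + 1), K n (σ n))
      (directed_of_isDirected_le fun M N hMN => biInter_subset_biInter_left fun n hn =>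
        Finset.range_mono (by omega) hn)
      (fun N => (hK 0 (σ 0)).of_isClosed_subset
        (isClosed_biInter fun n _ => (hK n _).isClosed)
        (biInter_subset_of_mem (by simp)))
      (fun N => isClosed_biInter fun n _ => (hK n _).isClosed)
      (fun z hz => hVo.mem_nhds (h1 hz))
    have h2 : ∀ᶠ τ in 𝓝 σ, ∀ n ∈ Finset.range (N + 1), τ n = σ n := by
      rw [Filter.eventually_all_finset]
      intro n _
      exact (continuous_apply n).tendsto σ ((isOpen_discrete {σ n}).mem_nhds rfl)
    filter_upwards [h2] with τ hτ y hy
    refine hN (mem_iInter₂.2 fun n hn => ?_)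
    rw [← hτ n hn]
    exact mem_iInter.1 hy n
  obtain ⟨y⟩ := ‹Nonempty Y›
  obtain ⟨σ₀, hσ₀⟩ := hPcof {y} isCompact_singleton
  obtain ⟨r, hrid, hrr, hrc⟩ := PiNat.exists_retraction_of_isClosed husc.isClosed_domain
    ⟨σ₀, y, hσ₀ rfl⟩
  have hne : ∀ σ, (P (r σ)).Nonempty := fun σ => by
    have := mem_range_self (f := r) σ
    rwa [hrr] at this
  have hcof' : ∀ L : Set Y, IsCompact L → ∃ σ, L ⊆ P (r σ) := fun L hL => by
    -- Adding `y` keeps the value nonempty even for empty `L`, so `r` fixes `σ`.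
    obtain ⟨σ, hσ⟩ := hPcof (insert y L) (hL.insert y)
    refine ⟨σ, ?_⟩
    rw [hrid σ ⟨y, hσ (mem_insert _ _)⟩]
    exact (subset_insert _ _).trans hσ
  refine ⟨fun σ => ⟨⟨P (r σ), hP _⟩, hne σ⟩, ?_, ?_, hcof'⟩
  · refine upperHemicontinuous_iff_forall_isOpen.2 fun σ V hV hσV => ?_
    exact hrc.tendsto σ (upperHemicontinuous_iff_forall_isOpen.1 husc (r σ) V hV hσV)
  · refine eq_univ_of_forall fun z => ?_
    obtain ⟨σ, hσ⟩ := hcof' {z} isCompact_singleton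
    exact mem_iUnion.2 ⟨σ, hσ rfl⟩

/-! ### Separable Banach spaces with the Schur property -/

theorem NormedSpace.exists_seq_strongDual_separating (X : Type*) [NormedAddCommGroup X]
    [NormedSpace ℝ X] [TopologicalSpace.SeparableSpace X] :
    ∃ g : ℕ → StrongDual ℝ X, ∀ x y, x ≠ y → ∃ n, g n x ≠ g n y := by
  choose g hg1 hg using fun n => exists_dual_vector'' ℝ (TopologicalSpace.denseSeq X n)
  refine ⟨g, fun x y hxy => ?_⟩
  by_contra! h
  have hpos : 0 < ‖x - y‖ := norm_pos_iff.2 (sub_ne_zero.2 hxy)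
  obtain ⟨n, hn⟩ := (TopologicalSpace.denseRange_denseSeq X).exists_dist_lt (x - y) (half_pos hpos)
  set d := TopologicalSpace.denseSeq X n
  rw [dist_eq_norm] at hn
  have h1 : g n (x - y - d) = -‖d‖ := by
    rw [map_sub, map_sub, h n, hg n, sub_self, zero_sub]
    rfl
  have h2 : ‖d‖ ≤ ‖x - y - d‖ := by
    have := (g n).le_of_opNorm_le (hg1 n) (x - y - d)
    rwa [h1, norm_neg, norm_norm, one_mul] at this
  have h3 := norm_sub_norm_le (x - y) d
  linarith

/-- Countably many functionals separate points, so `L` is metrizable and hence sequentially compact;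
Schur upgrades weak limits to norm limits. -/
theorem HasSchurProperty.isCompact_preimage_toWeakSpace {X : Type*} [NormedAddCommGroup X]
    [NormedSpace ℝ X] [TopologicalSpace.SeparableSpace X] (hX : HasSchurProperty X)
    {L : Set (WeakSpace ℝ X)} (hL : IsCompact L) : IsCompact (toWeakSpace ℝ X ⁻¹' L) := by
  have : CompactSpace L := isCompact_iff_compactSpace.1 hL
  obtain ⟨g, hg⟩ := NormedSpace.exists_seq_strongDual_separating X
  have : TopologicalSpace.MetrizableSpace L :=
    Metric.PiNatEmbed.TopologicalSpace.MetrizableSpace.of_countable_separating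
      (fun n (x : L) => g n ((toWeakSpace ℝ X).symm x))
      (fun n => (WeakBilin.eval_continuous (topDualPairing ℝ X).flip (g n)).comp
        continuous_subtype_val)
      fun x y hxy => hg _ _ ((toWeakSpace ℝ X).symm.injective.ne (Subtype.val_injective.ne hxy))
  refine IsSeqCompact.isCompact fun u hu => ?_
  obtain ⟨a, φ, hφ, ha⟩ := SeqCompactSpace.tendsto_subseq fun n => (⟨_, hu n⟩ : L)
  refine ⟨(toWeakSpace ℝ X).symm a, by simp, φ, hφ, hX _ _ ?_⟩
  rw [LinearEquiv.apply_symm_apply]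
  exact (continuous_subtype_val.tendsto a).comp ha

theorem NormedSpace.mem_range_inclusionInDoubleDual_of_forall_exists_dist_le {X : Type*}
    [NormedAddCommGroup X] [NormedSpace ℝ X] [CompleteSpace X]
    {z : StrongDual ℝ (StrongDual ℝ X)}
    (h : ∀ ε > 0, ∃ x, dist z (NormedSpace.inclusionInDoubleDual ℝ X x) ≤ ε) :
    ∃ x, NormedSpace.inclusionInDoubleDual ℝ X x = z := by
  have hi : Isometry (NormedSpace.inclusionInDoubleDualLi (E := X) ℝ) :=
    (NormedSpace.inclusionInDoubleDualLi (E := X) ℝ).isometry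
  have hc := hi.isClosedEmbedding.isClosed_range
  refine hc.closure_subset (Metric.mem_closure_iff.2 fun ε hε => ?_)
  obtain ⟨x, hx⟩ := h (ε / 2) (half_pos hε)
  exact ⟨_, ⟨x, rfl⟩, hx.trans_lt (half_lt_self hε)⟩

theorem IsOpen.exists_seq_ball {X : Type*} [PseudoMetricSpace X]
    [TopologicalSpace.SeparableSpace X] {U : Set X} (hU : IsOpen U) (hne : U.Nonempty) {ε : ℝ}
    (hε : 0 < ε) : ∃ (c : ℕ → X) (r : ℕ → ℝ), (∀ i, r i ≤ ε) ∧
      (∀ i, Metric.closedBall (c i) (r i) ⊆ U) ∧ U ⊆ ⋃ i, Metric.ball (c i) (r i) := by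
  have : ∀ x : X, ∃ r, 0 < r ∧ r ≤ ε ∧ (x ∈ U → Metric.closedBall x r ⊆ U) := fun x => by
    by_cases hx : x ∈ U
    · obtain ⟨r, hr, hrU⟩ := Metric.nhds_basis_closedBall.mem_iff.1 (hU.mem_nhds hx)
      exact ⟨min r ε, lt_min hr hε, min_le_right _ _, fun _ =>
        (Metric.closedBall_subset_closedBall (min_le_left _ _)).trans hrU⟩
    · exact ⟨ε, hε, le_rfl, fun h => absurd h hx⟩
  choose r hr hrε hrU using this
  have := UniformSpace.secondCountable_of_separable X
  obtain ⟨t, htU, htc, ht⟩ := TopologicalSpace.countable_cover_nhdsWithin (s := U)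
    (f := fun x => Metric.ball x (r x))
    fun x _ => mem_nhdsWithin_of_mem_nhds (Metric.ball_mem_nhds x (hr x))
  have htne : t.Nonempty := by
    obtain ⟨x, hx⟩ := hne
    obtain ⟨i, hi, -⟩ := mem_iUnion₂.1 (ht hx)
    exact ⟨i, hi⟩
  obtain ⟨c, rfl⟩ := htc.exists_eq_range htne
  refine ⟨c, fun i => r (c i), fun i => hrε _,
    fun i => hrU _ (htU (mem_range_self i)), ?_⟩
  rwa [biUnion_range] at ht

theorem IsGδ.isStronglyKSigmaDelta {X : Type*} [NormedAddCommGroup X] [NormedSpace ℝ X]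
    [CompleteSpace X] [TopologicalSpace.SeparableSpace X] (hX : HasSchurProperty X) {A : Set X}
    (hne : A.Nonempty) (hA : IsGδ A) :
    IsStronglyKSigmaDelta
      ((fun x : X => StrongDual.toWeakDual (NormedSpace.inclusionInDoubleDual ℝ X x)) '' A) := by
  obtain ⟨U, hU, rfl⟩ := isGδ_iff_eq_iInter_nat.1 hA
  choose c r hr hcU hUc using fun n : ℕ => (hU n).exists_seq_ball
    (hne.mono (iInter_subset U n)) (ε := 1 / ((n : ℝ) + 1)) (by positivity)
  let j : X → StrongDual ℝ (StrongDual ℝ X) :=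
    fun x => NormedSpace.inclusionInDoubleDual ℝ X x
  have hji : Isometry j := (NormedSpace.inclusionInDoubleDualLi (E := X) ℝ).isometry
  let K : ℕ → ℕ → Set (WeakDual ℝ (StrongDual ℝ X)) := fun n m => ⋃ i ∈ Finset.range m,
    WeakDual.toStrongDual ⁻¹' Metric.closedBall (j (c n i)) (r n i)
  have hKball : ∀ n m x, (∃ i < m, x ∈ Metric.closedBall (c n i) (r n i)) →
      StrongDual.toWeakDual (j x) ∈ K n m := by
    rintro n m x ⟨i, hi, hx⟩
    refine mem_iUnion₂.2 ⟨i, Finset.mem_range.2 hi, ?_⟩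
    change dist (j x) (j (c n i)) ≤ r n i
    rwa [hji.dist_eq]
  refine ⟨K, fun n m => (Finset.range m).isCompact_biUnion fun i _ =>
    WeakDual.isCompact_closedBall _ _, Subset.antisymm ?_ ?_, ?_⟩
  · rintro _ ⟨x, hx, rfl⟩
    refine mem_iInter.2 fun n => ?_
    obtain ⟨i, hi⟩ := mem_iUnion.1 (hUc n (mem_iInter.1 hx n))
    exact mem_iUnion.2 ⟨i + 1, hKball n _ x ⟨i, i.lt_succ_self, Metric.ball_subset_closedBall hi⟩⟩
  · intro z hz
    have hz' : ∀ n, ∃ i, dist (WeakDual.toStrongDual z) (j (c n i)) ≤ r n i := fun n => by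
      obtain ⟨m, hm⟩ := mem_iUnion.1 (mem_iInter.1 hz n)
      obtain ⟨i, -, hi⟩ := mem_iUnion₂.1 hm
      exact ⟨i, hi⟩
    obtain ⟨x, hx⟩ := NormedSpace.mem_range_inclusionInDoubleDual_of_forall_exists_dist_le
      (z := WeakDual.toStrongDual z) fun ε hε => by
        obtain ⟨n, hn⟩ := exists_nat_one_div_lt hε
        obtain ⟨i, hi⟩ := hz' n
        exact ⟨c n i, hi.trans ((hr n i).trans hn.le)⟩
    refine ⟨x, mem_iInter.2 fun n => ?_, ?_⟩
    · obtain ⟨i, hi⟩ := hz' n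
      rw [← hx] at hi
      -- The embedding is isometric, so a bidual ball centred in `X` meets `X` in the original ball.
      exact hcU n i ((hji.dist_eq x (c n i)).symm.trans_le hi)
    · change StrongDual.toWeakDual (NormedSpace.inclusionInDoubleDual ℝ X x) = z
      rw [hx]
      rfl
  · intro L hL hLA n
    have he := NormedSpace.isEmbedding_inclusionInDoubleDualWeak ℝ X
    have hL' : IsCompact (NormedSpace.inclusionInDoubleDualWeak ℝ X ⁻¹' L) :=
      he.isInducing.isCompact_preimage' hL (hLA.trans (by
        rintro _ ⟨x, -, rfl⟩
        exact ⟨toWeakSpace ℝ X x, rfl⟩))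
    have hc := hX.isCompact_preimage_toWeakSpace hL'
    have hmem : ∀ x, StrongDual.toWeakDual (j x) ∈ L → x ∈ ⋂ n, U n := fun x hx => by
      obtain ⟨y, hy, hyx⟩ := hLA hx
      rwa [← hji.injective (StrongDual.toWeakDual.injective hyx)]
    obtain ⟨t, ht⟩ := hc.elim_finite_subcover (fun i => Metric.ball (c n i) (r n i))
      (fun i => Metric.isOpen_ball) fun x hx => hUc n (mem_iInter.1 (hmem x hx) n)
    obtain ⟨m, hm⟩ := t.exists_nat_subset_range
    refine ⟨m, fun z hz => ?_⟩
    obtain ⟨x, -, rfl⟩ := hLA hz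
    obtain ⟨i, hi, hxi⟩ := mem_iUnion₂.1 (ht (show x ∈ _ from hz))
    exact hKball n m x ⟨i, Finset.mem_range.1 (hm hi), Metric.ball_subset_closedBall hxi⟩

theorem mainTheorem11 {X : Type*} [NormedAddCommGroup X] [NormedSpace ℝ X] [CompleteSpace X]
    [TopologicalSpace.SeparableSpace X] (hX : HasSchurProperty X) (A : Set X) (hA : A.Nonempty) :
    List.TFAE
      [ -- `A` with the weak topology is strongly K-analytic
        IsStronglyKAnalytic (toWeakSpace ℝ X '' A),
        -- `A` is a norm `G_δ` subset of `X`
        IsGδ A,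
        -- `A` with the norm topology is a Polish space
        PolishSpace A,
        -- the canonical image of `A` is strongly `K_{σδ}` in the bidual with its weak* topology
        IsStronglyKSigmaDelta
          ((fun x : X => StrongDual.toWeakDual (NormedSpace.inclusionInDoubleDual ℝ X x)) '' A)] := by
  tfae_have 1 → 2 := fun h =>
    IsGδ.of_isStronglyKAnalytic_image (toWeakSpaceCLM ℝ X).continuous (toWeakSpace ℝ X).injective h
  tfae_have 2 → 3 := fun h => by
    have := UniformSpace.secondCountable_of_separable X
    exact h.polishSpace
  tfae_have 3 → 2 := fun _ => IsGδ.of_isCompletelyMetrizableSpace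
  tfae_have 2 → 4 := fun h => h.isStronglyKSigmaDelta hX hA
  tfae_have 4 → 1 := fun h => by
    have : Nonempty (toWeakSpace ℝ X '' A) := (hA.image _).to_subtype
    refine IsStronglyKSigmaDelta.isStronglyKAnalytic
      ((NormedSpace.isEmbedding_inclusionInDoubleDualWeak ℝ X).comp .subtypeVal) ?_
    rw [range_comp, Subtype.range_coe, image_image]
    exact h
  tfae_finish
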